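/- Let $k$ be an odd positive integer and let $\chi$ be a non-principal primitive Dirichlet character modulo $k$, with complex conjugate $\bar\chi$. Let $B_n(x)$ and $E_n(x)$ be the Bernoulli and Euler polynomials, $\frac{te^{xt}}{e^t-1}=\sum_{n\ge0}B_n(x)\frac{t^n}{n!}$ and $\frac{2e^{xt}}{e^t+1}=\sum_{n\ge0}E_n(x)\frac{t^n}{n!}$. For $0\le x<1$ and $m\in\mathbb Z$ define the Bernoulli functions by $\mathfrak B_n(x+m)=B_n(x)$ if $n\ne1$ or $x\ne0$, and $\mathfrak B_1(m)=0$; and the Euler functions by $\mathcal E_n(x+m)=(-1)^mE_n(x)$. For real $x$ put $$\mathfrak B_{m,\chi}(x)=k^{m-1}\sum_{j=0}^{k-1}\bar\chi(j)\,\mathfrak B_m\!\left(\tfrac{j+x}{k}\right)\ (m\ge1),\qquad \mathcal E_{m,\chi}(x)=k^{m}\sum_{j=0}^{k-1}(-1)^j\bar\chi(j)\,\mathcal E_m\!\left(\tfrac{j+x}{k}\right)\ (m\ge0).$$ For integers $p\ge 1$, $d$, and $c>0$ let $$s_{1,p}(d,c:\chi)=\sum_{n=1}^{ck}\chi(n)\,\mathcal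 E_{p-1,\chi}\!\left(\tfrac{dn}{c}\right)\mathfrak B_1\!\left(\tfrac{n}{ck}\right),\qquad s_{2,p}(d,c:\chi)=\sum_{n=1}^{ck}(-1)^n\chi(n)\,\mathfrak B_{p,\chi}\!\left(\tfrac{dn}{c}\right)\mathfrak B_1\!\left(\tfrac{n}{ck}\right),$$ and $s_j=s_{j,1}$ for $j=1,2$. **Theorem.** Let $d$ and $c$ be coprime positive integers with $d$ even, and suppose that $d\equiv0$ or $c\equiv0\pmod k$. Then for every odd $p\ge1$ $$p\,d\,c^{p}\,s_{1,p}(d,c:\bar\chi)-2\,c\,d^{p}\,s_{2,p}(c,d:\chi)=\chi(-1)\sum_{m=1}^{p}(-1)^m\binom{p}{m-1}c^{m}d^{\,p+1-m}\,\mathfrak B_{p+1-m,\chi}(0)\,\mathcal E_{m-1,\bar\chi}(0).$$ In particular, $$s_1(d,c:\bar\chi)-2\,s_2(c,d:\chi)=-\chi(-1)\,\mathfrak B_{1,\chi}(0)\,\mathcal E_{0,\bar\chi}(0).$$ -/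

import Mathlib

open scoped Nat

noncomputable section

namespace HardyBerndt

/-- The Bernoulli function `𝔅ₙ(x)`: the 1-periodic extension of `Bₙ(x)`, `0 ≤ x < 1`, except that
`𝔅₁` vanishes at the integers. -/
def bernoulliFn (n : ℕ) (x : ℝ) : ℝ :=
  if n = 1 ∧ Int.fract x = 0 then 0
  else Polynomial.aeval (Int.fract x) (Polynomial.bernoulli n)

/-- The Euler polynomial `Eₙ(x)`, as `n!` times the coefficient of `tⁿ` in the power series
`2 e^{xt} / (e^t + 1)`. -/
def eulerPoly (n : ℕ) (x : ℝ) : ℝ :=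
  (n ! : ℝ) * PowerSeries.coeff n
    (2 * PowerSeries.rescale x (PowerSeries.exp ℝ) * (PowerSeries.exp ℝ + 1)⁻¹)

/-- The defining generating function identity of the Euler polynomials (the inverse of
`e^t + 1` above is a genuine inverse). -/
theorem eulerPoly_generating_function (x : ℝ) :
    (PowerSeries.mk fun n => eulerPoly n x / (n ! : ℝ)) * (PowerSeries.exp ℝ + 1) =
      2 * PowerSeries.rescale x (PowerSeries.exp ℝ) := by
  have h : (PowerSeries.mk fun n => eulerPoly n x / (n ! : ℝ)) =
      2 * PowerSeries.rescale x (PowerSeries.exp ℝ) * (PowerSeries.exp ℝ + 1)⁻¹ := by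
    ext n
    have hn : (n ! : ℝ) ≠ 0 := by positivity
    rw [PowerSeries.coeff_mk, eulerPoly]
    field_simp
  have h0 : PowerSeries.constantCoeff (PowerSeries.exp ℝ + 1) ≠ 0 := by
    simp
  rw [h, mul_assoc, PowerSeries.inv_mul_cancel _ h0, mul_one]

/-- The Euler function `𝓔ₙ(x)`: `𝓔ₙ(x) = Eₙ(x)` for `0 ≤ x < 1` and
`𝓔ₙ(x + m) = (-1)ᵐ 𝓔ₙ(x)` for integers `m`. -/
def eulerFn (n : ℕ) (x : ℝ) : ℝ :=
  (-1 : ℝ) ^ ⌊x⌋ * eulerPoly n (Int.fract x)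

/-- The generalized Bernoulli function `𝔅_{m,χ}(x)`, for `m ≥ 1`. -/
def bernoulliChi {k : ℕ} (m : ℕ) (χ : DirichletCharacter ℂ k) (x : ℝ) : ℂ :=
  (k : ℂ) ^ (m - 1) *
    ∑ j ∈ Finset.range k,
      starRingEnd ℂ (χ (j : ZMod k)) * (bernoulliFn m (((j : ℝ) + x) / (k : ℝ)) : ℂ)

/-- The character Euler function `𝓔_{m,χ}(x)`, for `m ≥ 0` and odd modulus `k`. -/
def eulerChi {k : ℕ} (m : ℕ) (χ : DirichletCharacter ℂ k) (x : ℝ) : ℂ :=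
  (k : ℂ) ^ m *
    ∑ j ∈ Finset.range k,
      (-1 : ℂ) ^ j * starRingEnd ℂ (χ (j : ZMod k)) *
        (eulerFn m (((j : ℝ) + x) / (k : ℝ)) : ℂ)

/-- The character Hardy--Berndt sum `s_{1,p}(d,c:χ)`. -/
def s1 {k : ℕ} (p : ℕ) (d : ℤ) (c : ℕ) (χ : DirichletCharacter ℂ k) : ℂ :=
  ∑ n ∈ Finset.Icc 1 (c * k),
    χ (n : ZMod k) * eulerChi (p - 1) χ ((d : ℝ) * (n : ℝ) / (c : ℝ)) *
      (bernoulliFn 1 ((n : ℝ) / ((c : ℝ) * (k : ℝ))) : ℂ)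

/-- The character Hardy--Berndt sum `s_{2,p}(d,c:χ)`. -/
def s2 {k : ℕ} (p : ℕ) (d : ℤ) (c : ℕ) (χ : DirichletCharacter ℂ k) : ℂ :=
  ∑ n ∈ Finset.Icc 1 (c * k),
    (-1 : ℂ) ^ n * χ (n : ZMod k) * bernoulliChi p χ ((d : ℝ) * (n : ℝ) / (c : ℝ)) *
      (bernoulliFn 1 ((n : ℝ) / ((c : ℝ) * (k : ℝ))) : ℂ)

end HardyBerndt

end

open scoped Nat

noncomputable section

namespace HardyBerndt

/-! Both sums are half of one double sum. Writing Euler functions as differences of Bernoulli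
functions at half arguments (`eulerFn_eq_bernoulliFn`) and spreading residues with the
multiplication theorem (`sum_periodic_mul_bernoulliFn`) turns `s1` and `s2`, up to constants, into
sums over `n` mod `kc` and `J` mod `kd`, with weight `conj χ(n) (-1)^J χ(J)`, of `𝔅_p(u+v) 𝔅₁(u)`
and `𝔅_p(u+v) 𝔅₁(v)`, where `u = n/(kc)` and `v = J/(kd)`.

Since `B₁(u) + B₁(v) = u + v - 1`, a product formula read off from generating functions
(`bernoulliFn_product_formula`) expands `(p+1) 𝔅_p(u+v) (𝔅₁(u) + 𝔅₁(v))` into products `𝔅_i(u)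
𝔅_{p+1-i}(v)` plus `p 𝔅_{p+1}(u+v)`. The last term sums to zero: a shear of the index set fixes
`u+v` mod 1 but averages one of the characters to zero (`sum_sum_periodic_eq_zero`). The products
factor into values of `bernoulliChi` and `eulerChi` at 0, and the parity of `bernoulliChi` at 0
accounts for the signs and for `χ(-1)`. -/

/-! ### Generating functions and the product formula for Bernoulli polynomials -/

/-- The exponential generating series `∑ Bₙ(x) tⁿ / n!` of the Bernoulli polynomials. -/
def bernoulliSeries (x : ℝ) : PowerSeries ℝ :=
  PowerSeries.mk fun n => bernoulliFun n x / (n ! : ℝ)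

theorem bernoulliSeries_mul_exp_sub_one (x : ℝ) :
    bernoulliSeries x * (PowerSeries.exp ℝ - 1) =
      PowerSeries.X * PowerSeries.rescale x (PowerSeries.exp ℝ) := by
  rw [← Polynomial.bernoulli_generating_function]
  congr 1
  ext n
  simp [bernoulliSeries, bernoulliFun, div_eq_inv_mul, Algebra.smul_def, Polynomial.aeval_def,
    Polynomial.eval_map]

theorem derivative_rescale_exp (x : ℝ) :
    PowerSeries.derivative ℝ (PowerSeries.rescale x (PowerSeries.exp ℝ)) =
      PowerSeries.C x * PowerSeries.rescale x (PowerSeries.exp ℝ) := by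
  ext n
  have h : ((n : ℝ) + 1) ≠ 0 := by positivity
  rw [PowerSeries.coeff_derivative]
  simp [PowerSeries.coeff_rescale, PowerSeries.coeff_exp, Nat.factorial_succ]
  field_simp
  ring

theorem rescale_one_exp :
    PowerSeries.rescale (1 : ℝ) (PowerSeries.exp ℝ) = PowerSeries.exp ℝ := by
  simp

theorem exp_sub_one_ne_zero : PowerSeries.exp ℝ - 1 ≠ 0 := by
  intro h
  have := congrArg (PowerSeries.coeff 1) h
  simp [PowerSeries.coeff_exp, PowerSeries.coeff_one] at this

/-- The product of two Bernoulli series as a first-order differential expression in a third. -/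
theorem bernoulliSeries_mul_bernoulliSeries {u v w : ℝ} (hw : w = u + v ∨ w = u + v - 1) :
    PowerSeries.C (u + v - 1) * (PowerSeries.X * bernoulliSeries w) =
      bernoulliSeries u * bernoulliSeries v +
        PowerSeries.X * PowerSeries.derivative ℝ (bernoulliSeries w) - bernoulliSeries w := by
  have hu := bernoulliSeries_mul_exp_sub_one u
  have hv := bernoulliSeries_mul_exp_sub_one v
  have hs := bernoulliSeries_mul_exp_sub_one w
  have hd := congrArg (PowerSeries.derivative ℝ) hs
  simp only [Derivation.leibniz, map_sub, PowerSeries.derivative_exp, PowerSeries.derivative_one,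
    derivative_rescale_exp, PowerSeries.derivative_X, smul_eq_mul, sub_zero, mul_one] at hd
  -- After multiplication by `(e^t - 1)²` every series, and the derivative via `hd`, becomes an
  -- expression in exponentials.
  refine mul_right_cancel₀ (pow_ne_zero 2 exp_sub_one_ne_zero) ?_
  rcases hw with hw | hw
  · have he := PowerSeries.exp_mul_exp_eq_exp_add (A := ℝ) u v
    rw [← hw] at he
    have hC : PowerSeries.C (u + v - 1) = PowerSeries.C w - 1 := by rw [← hw]; simp
    rw [hC]
    generalize PowerSeries.derivative ℝ (bernoulliSeries w) = S' at *
    generalize PowerSeries.rescale w (PowerSeries.exp ℝ) = R at *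
    generalize PowerSeries.rescale u (PowerSeries.exp ℝ) = Ru at *
    generalize PowerSeries.rescale v (PowerSeries.exp ℝ) = Rv at *
    generalize PowerSeries.exp ℝ = E at *
    generalize (PowerSeries.C w : PowerSeries ℝ) = W at *
    generalize bernoulliSeries w = S at *
    generalize bernoulliSeries u = U at *
    generalize bernoulliSeries v = V at *
    generalize (PowerSeries.X : PowerSeries ℝ) = X at *
    linear_combination (X * W * (E - 1) - X * (E - 1) + X * E + (E - 1)) * hs -
      X * (E - 1) * hd - V * (E - 1) * hu - X * Ru * hv - X ^ 2 * he
  · have he := PowerSeries.exp_mul_exp_eq_exp_add (A := ℝ) u v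
    -- Here `e^{ut} e^{vt} = e^{wt} e^t`; the extra `e^t` offsets the change from `w - 1` to `w` in
    -- the linear factor.
    have he' := PowerSeries.exp_mul_exp_eq_exp_add (A := ℝ) w 1
    rw [rescale_one_exp, show w + 1 = u + v by rw [hw]; ring, ← he] at he'
    rw [← hw]
    clear he
    generalize PowerSeries.derivative ℝ (bernoulliSeries w) = S' at *
    generalize PowerSeries.rescale w (PowerSeries.exp ℝ) = R at *
    generalize PowerSeries.rescale u (PowerSeries.exp ℝ) = Ru at *
    generalize PowerSeries.rescale v (PowerSeries.exp ℝ) = Rv at *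
    generalize PowerSeries.exp ℝ = E at *
    generalize (PowerSeries.C w : PowerSeries ℝ) = W at *
    generalize bernoulliSeries w = S at *
    generalize bernoulliSeries u = U at *
    generalize bernoulliSeries v = V at *
    generalize (PowerSeries.X : PowerSeries ℝ) = X at *
    linear_combination (X * W * (E - 1) + X * E + (E - 1)) * hs - X * (E - 1) * hd -
      V * (E - 1) * hu - X * Ru * hv + X ^ 2 * he'

/-- Coefficient of `t^{p+1}` in the series identity. The two choices of `w` serve `u, v` in `[0,1)`
without and with a carry in `u + v`. -/
theorem bernoulliFun_product_formula (p : ℕ) {u v w : ℝ} (hw : w = u + v ∨ w = u + v - 1) :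
    ((p : ℝ) + 1) * (u + v - 1) * bernoulliFun p w =
      ∑ i ∈ Finset.range (p + 2),
          ((p + 1).choose i : ℝ) * bernoulliFun i u * bernoulliFun (p + 1 - i) v +
        p * bernoulliFun (p + 1) w := by
  have h := congrArg (PowerSeries.coeff (p + 1)) (bernoulliSeries_mul_bernoulliSeries hw)
  rw [PowerSeries.coeff_C_mul, map_sub, map_add, PowerSeries.coeff_succ_X_mul,
    PowerSeries.coeff_succ_X_mul, PowerSeries.coeff_derivative, PowerSeries.coeff_mul,
    Finset.Nat.sum_antidiagonal_eq_sum_range_succ_mk] at h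
  simp only [bernoulliSeries, PowerSeries.coeff_mk] at h
  have hp : (p ! : ℝ) ≠ 0 := by positivity
  have hs : ∑ i ∈ Finset.range (p + 2),
      ((p + 1).choose i : ℝ) * bernoulliFun i u * bernoulliFun (p + 1 - i) v =
      ((p + 1)! : ℝ) * ∑ i ∈ Finset.range (p + 1).succ,
        bernoulliFun i u / (i ! : ℝ) * (bernoulliFun (p + 1 - i) v / ((p + 1 - i)! : ℝ)) := by
    rw [Finset.mul_sum]
    refine Finset.sum_congr rfl fun i hi => ?_
    rw [Nat.cast_choose ℝ (Nat.lt_succ_iff.mp (Finset.mem_range.mp hi))]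
    ring
  rw [hs]
  have hf : ((p + 1)! : ℝ) = (p + 1) * p ! := by rw [Nat.factorial_succ]; push_cast; ring
  have hp1 : (p : ℝ) + 1 ≠ 0 := by positivity
  generalize ∑ i ∈ Finset.range (p + 1).succ,
        bernoulliFun i u / (i ! : ℝ) * (bernoulliFun (p + 1 - i) v / ((p + 1 - i)! : ℝ)) = Q at *
  rw [hf] at h ⊢
  field_simp at h
  linear_combination h

/-! ### Periodic Bernoulli functions -/

theorem bernoulliFn_eq_of_ne {n : ℕ} {x : ℝ} (h : n ≠ 1 ∨ Int.fract x ≠ 0) :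
    bernoulliFn n x = bernoulliFun n (Int.fract x) := by
  rw [bernoulliFn, if_neg (by tauto), bernoulliFun, Polynomial.aeval_def, Polynomial.eval_map]

theorem bernoulliFn_add_int (n : ℕ) (x : ℝ) (m : ℤ) :
    bernoulliFn n (x + m) = bernoulliFn n x := by
  simp [bernoulliFn]

theorem bernoulliFn_add_one (n : ℕ) (x : ℝ) : bernoulliFn n (x + 1) = bernoulliFn n x := by
  simp [bernoulliFn]

theorem bernoulliFn_zero_left (x : ℝ) : bernoulliFn 0 x = 1 := by
  simp [bernoulliFn]

/-- The fractional part of `u + v` is one of the two admissible `w`. The convention `𝔅₁ = 0` at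
integers does no harm: when `u + v` is an integer, the fractional parts add to 1 and the factor
`𝔅₁(u) + 𝔅₁(v)` is zero. -/
theorem bernoulliFn_product_formula {p : ℕ} (hp : 1 ≤ p) {u v : ℝ}
    (hu : Int.fract u ≠ 0) (hv : Int.fract v ≠ 0) :
    ((p : ℝ) + 1) * (bernoulliFn p (u + v) * (bernoulliFn 1 u + bernoulliFn 1 v)) =
      ∑ i ∈ Finset.range (p + 2),
          ((p + 1).choose i : ℝ) * bernoulliFn i u * bernoulliFn (p + 1 - i) v +
        p * bernoulliFn (p + 1) (u + v) := by
  have hw : Int.fract (u + v) = Int.fract u + Int.fract v ∨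
      Int.fract (u + v) = Int.fract u + Int.fract v - 1 := by
    obtain ⟨z, hz⟩ := Int.fract_add u v
    have h0 := Int.fract_nonneg (u + v)
    have h1 := Int.fract_lt_one (u + v)
    have hu0 := Int.fract_nonneg u
    have hu1 := Int.fract_lt_one u
    have hv0 := Int.fract_nonneg v
    have hv1 := Int.fract_lt_one v
    have hz0 : (z : ℝ) < 1 := by linarith
    have hz1 : (-2 : ℝ) < z := by linarith
    have hz0' : z < 1 := by exact_mod_cast hz0
    have hz1' : -2 < z := by exact_mod_cast hz1
    obtain rfl | rfl : z = 0 ∨ z = -1 := by omega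
    · left; push_cast at hz; linarith
    · right; push_cast at hz; linarith
  simp only [fun n => bernoulliFn_eq_of_ne (n := n) (Or.inr hu),
    fun n => bernoulliFn_eq_of_ne (n := n) (Or.inr hv)]
  rw [bernoulliFn_eq_of_ne (n := p + 1) (x := u + v) (Or.inl (by omega)),
    ← bernoulliFun_product_formula p hw, bernoulliFun_one, bernoulliFun_one]
  by_cases h : p ≠ 1 ∨ Int.fract (u + v) ≠ 0
  · rw [bernoulliFn_eq_of_ne h]
    ring
  · push Not at h
    have h0 : Int.fract u + Int.fract v = 1 := by
      have := Int.fract_nonneg u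
      have := Int.fract_nonneg v
      rcases hw with hw | hw
      · exact absurd (by linarith [h.2]) hu
      · linarith [h.2]
    linear_combination ((p : ℝ) + 1) *
      (bernoulliFn p (u + v) - bernoulliFun p (Int.fract (u + v))) * h0

/-! ### Sums of periodic functions and the multiplication theorem -/

theorem sum_range_add_of_periodic {M : Type*} [AddCommMonoid M] {F : ℕ → M} {N : ℕ}
    (hF : Function.Periodic F N) (m : ℕ) :
    ∑ i ∈ Finset.range N, F (i + m) = ∑ i ∈ Finset.range N, F i := by
  induction m with
  | zero => rfl
  | succ m ih =>
    rw [← ih]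
    cases N with
    | zero => rfl
    | succ N =>
      rw [Finset.sum_range_succ, Finset.sum_range_succ' (fun i => F (i + m))]
      congr 1
      · exact Finset.sum_congr rfl fun i _ => by congr 1; omega
      · rw [← hF (0 + m)]; congr 1; omega

theorem sum_range_mul_eq {M : Type*} [AddCommMonoid M] (F : ℕ → M) (k N : ℕ) :
    ∑ n ∈ Finset.range (k * N), F n =
      ∑ j ∈ Finset.range k, ∑ a ∈ Finset.range N, F (j + k * a) := by
  rw [Finset.sum_comm]
  induction N with
  | zero => simp
  | succ N ih =>
    rw [Nat.mul_succ, Finset.sum_range_add, ih, Finset.sum_range_succ]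
    congr 1
    exact Finset.sum_congr rfl fun i _ => by rw [add_comm]

theorem sum_Icc_one_eq_sum_range {M : Type*} [AddCommMonoid M] {F : ℕ → M} {N : ℕ}
    (h : F N = F 0) : ∑ n ∈ Finset.Icc 1 N, F n = ∑ n ∈ Finset.range N, F n := by
  cases N with
  | zero => simp
  | succ N =>
    rw [Finset.sum_range_succ', ← h, ← Finset.sum_range_succ (fun n => F (n + 1)),
      Finset.range_eq_Ico, Finset.sum_Ico_add' F 0 (N + 1) 1]
    rfl

/-- The multiplication theorem for the Bernoulli functions. -/
theorem bernoulliFn_mul (p : ℕ) {N : ℕ} (hN : N ≠ 0) (x : ℝ) :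
    bernoulliFn p (N * x) =
      (N : ℝ) ^ p / N * ∑ i ∈ Finset.range N, bernoulliFn p (x + i / N) := by
  have hN0 : (0 : ℝ) < N := by positivity
  -- In this range all the points `y + i/N` lie in `[0,1)`, so the polynomial identity applies
  -- directly.
  have key : ∀ y : ℝ, 0 ≤ y → N * y < 1 → bernoulliFn p (N * y) =
      (N : ℝ) ^ p / N * ∑ i ∈ Finset.range N, bernoulliFn p (y + i / N) := by
    intro y hy0 hy1
    have hfr : Int.fract (N * y) = N * y := Int.fract_eq_self.2 ⟨by positivity, hy1⟩
    have hfi : ∀ i ∈ Finset.range N, Int.fract (y + i / N) = y + i / N := by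
      intro i hi
      refine Int.fract_eq_self.2 ⟨by positivity, ?_⟩
      have hi' : (i : ℝ) + 1 ≤ N := by exact_mod_cast Finset.mem_range.mp hi
      have : y + i / N = (N * y + i) / N := by field_simp
      rw [this, div_lt_one hN0]
      linarith
    -- In this case the left side and the `i = 0` term both carry the polynomial value `B₁(0)`, and
    -- the convention replaces both by 0.
    by_cases h : p = 1 ∧ y = 0
    · obtain ⟨rfl, rfl⟩ := h
      have hm := bernoulliFun_mul 1 hN 0
      obtain ⟨N, rfl⟩ := Nat.exists_eq_succ_of_ne_zero hN
      have e : ((N.succ : ℕ) : ℝ) ^ 1 / (N.succ : ℕ) = 1 := by rw [pow_one, div_self hN0.ne']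
      rw [e, one_mul, Finset.sum_range_succ'] at hm ⊢
      have h1 : ∀ i ∈ Finset.range N, bernoulliFn 1 (0 + ((i + 1 : ℕ) : ℝ) / (N.succ : ℕ)) =
          bernoulliFun 1 (0 + ((i + 1 : ℕ) : ℝ) / (N.succ : ℕ)) := by
        intro i hi
        have := hfi (i + 1) (by simpa using hi)
        rw [bernoulliFn_eq_of_ne (Or.inr _), this]
        rw [this]
        positivity
      rw [Finset.sum_congr rfl h1]
      simp only [mul_zero, Nat.cast_zero, zero_div, add_zero] at hm ⊢
      have h0 : bernoulliFn 1 0 = 0 := by simp [bernoulliFn]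
      rw [h0]
      linarith
    · have hy : p ≠ 1 ∨ y ≠ 0 := by tauto
      rw [bernoulliFn_eq_of_ne, hfr, bernoulliFun_mul p hN]
      · congr 1
        refine Finset.sum_congr rfl fun i hi => ?_
        rw [bernoulliFn_eq_of_ne, hfi i hi]
        refine hy.imp_right fun hy => ?_
        rw [hfi i hi]
        have : 0 < y := lt_of_le_of_ne hy0 (Ne.symm hy)
        positivity
      · refine hy.imp_right fun hy => ?_
        rw [hfr]
        positivity
  -- In general `x = y + z/N` with `z` an integer, and adding `z/N` permutes the points `y + i/N`
  -- modulo 1.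
  set y : ℝ := Int.fract (N * x) / N with hy
  set z : ℤ := ⌊(N : ℝ) * x⌋ with hz
  have hNy : N * y = Int.fract (N * x) := by rw [hy]; field_simp
  have hx : N * x = N * y + z := by rw [hNy, hz]; exact (Int.fract_add_floor _).symm
  have hk := key y (div_nonneg (Int.fract_nonneg _) hN0.le) (by rw [hNy]; exact Int.fract_lt_one _)
  rw [hx, bernoulliFn_add_int, hk]
  congr 1
  let F : ℕ → ℝ := fun i => bernoulliFn p (y + i / N)
  have hF : Function.Periodic F N := by
    intro i
    have : y + ((i + N : ℕ) : ℝ) / N = y + i / N + 1 := by push_cast; field_simp; ring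
    simp only [F, this, bernoulliFn_add_one]
  rw [← sum_range_add_of_periodic hF (z % N).toNat]
  refine Finset.sum_congr rfl fun i _ => ?_
  have hr : (((z % N).toNat : ℕ) : ℝ) + N * ((z / N : ℤ) : ℝ) = z := by
    have h1 : ((z % N).toNat : ℤ) = z % N :=
      Int.toNat_of_nonneg (Int.emod_nonneg _ (by exact_mod_cast hN))
    have h2 : ((z % N).toNat : ℤ) + N * (z / N) = z := by rw [h1]; exact Int.emod_add_mul_ediv z N
    exact_mod_cast h2
  have hx' : x + i / N = y + ((i + (z % N).toNat : ℕ) : ℝ) / N + ((z / N : ℤ) : ℝ) := by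
    have : x = (N * y + z) / N := by rw [← hx]; field_simp
    rw [this]
    push_cast
    field_simp
    linarith
  rw [hx', bernoulliFn_add_int]

/-- The multiplication theorem twisted by a periodic function. -/
theorem sum_periodic_mul_bernoulliFn (p : ℕ) {k N : ℕ} (hk : k ≠ 0) (hN : N ≠ 0) {g : ℕ → ℂ}
    (hg : Function.Periodic g k) (x : ℝ) :
    (N : ℂ) ^ p / N * ∑ n ∈ Finset.range (k * N),
        g n * (bernoulliFn p (n / (k * N : ℝ) + x) : ℂ) =
      ∑ j ∈ Finset.range k, g j * (bernoulliFn p (j / k + N * x) : ℂ) := by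
  have hk0 : (k : ℝ) ≠ 0 := by exact_mod_cast hk
  have hN0 : (N : ℝ) ≠ 0 := by exact_mod_cast hN
  rw [sum_range_mul_eq, Finset.mul_sum]
  refine Finset.sum_congr rfl fun j _ => ?_
  have h1 : (j / k + N * x : ℝ) = N * (j / (k * N) + x) := by field_simp
  rw [h1, bernoulliFn_mul p hN]
  push_cast
  rw [mul_left_comm, Finset.mul_sum, Finset.mul_sum, Finset.mul_sum]
  refine Finset.sum_congr rfl fun a _ => ?_
  have h2 : (((j : ℝ) + k * a) / (k * N) + x : ℝ) = j / (k * N) + x + a / N := by field_simp; ring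
  have h3 : g (j + k * a) = g j := by
    have := hg.nsmul a j
    rwa [smul_eq_mul, mul_comm] at this
  rw [h2, h3]

/-! ### Reflection, and Euler functions as differences of Bernoulli functions -/

theorem bernoulliFn_neg (n : ℕ) {x : ℝ} (hx : Int.fract x ≠ 0) :
    bernoulliFn n (-x) = (-1) ^ n * bernoulliFn n x := by
  have h := Int.fract_neg hx
  rw [bernoulliFn_eq_of_ne (Or.inr hx), bernoulliFn_eq_of_ne, h, bernoulliFun_eval_one_sub]
  right
  rw [h]
  linarith [Int.fract_lt_one x]

/-- Multiply `2e^{xt}/(e^t+1)` by `t(e^t-1)/(e^t-1)`: the result `2t(e^{(x+1)t} -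
e^{xt})/(e^{2t}-1)` is a difference of Bernoulli series in the variable `2t`. -/
theorem eulerPoly_eq_bernoulliFun (n : ℕ) (x : ℝ) :
    eulerPoly n x = 2 ^ (n + 1) / (n + 1) *
      (bernoulliFun (n + 1) ((x + 1) / 2) - bernoulliFun (n + 1) (x / 2)) := by
  have h : PowerSeries.X * (PowerSeries.mk fun n => eulerPoly n x / (n ! : ℝ)) =
      PowerSeries.rescale 2 (bernoulliSeries ((x + 1) / 2)) -
        PowerSeries.rescale 2 (bernoulliSeries (x / 2)) := by
    have h1 := congrArg (PowerSeries.rescale 2) (bernoulliSeries_mul_exp_sub_one ((x + 1) / 2))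
    have h2 := congrArg (PowerSeries.rescale 2) (bernoulliSeries_mul_exp_sub_one (x / 2))
    have h3 := eulerPoly_generating_function x
    have h4 := PowerSeries.exp_mul_exp_eq_exp_add (A := ℝ) x 1
    have h5 := PowerSeries.exp_mul_exp_eq_exp_add (A := ℝ) 1 1
    rw [rescale_one_exp, one_add_one_eq_two] at h5
    rw [rescale_one_exp] at h4
    simp only [map_mul, map_sub, map_one, PowerSeries.rescale_rescale, PowerSeries.rescale_X]
      at h1 h2
    rw [show (x + 1) / 2 * 2 = x + 1 by ring] at h1
    rw [show x / 2 * 2 = x by ring] at h2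
    have hC : (PowerSeries.C (2 : ℝ)) = 2 := map_ofNat _ 2
    rw [hC] at h1 h2
    have hne : PowerSeries.rescale (2 : ℝ) (PowerSeries.exp ℝ) - 1 ≠ 0 := by
      intro h
      have := congrArg (PowerSeries.coeff 1) h
      simp [PowerSeries.coeff_exp, PowerSeries.coeff_one, PowerSeries.coeff_rescale] at this
    refine mul_right_cancel₀ hne ?_
    rw [sub_mul, h1, h2, ← h4, ← h5]
    linear_combination (PowerSeries.X * (PowerSeries.exp ℝ - 1)) * h3
  have hc := congrArg (PowerSeries.coeff (n + 1)) h
  rw [PowerSeries.coeff_succ_X_mul, map_sub, PowerSeries.coeff_rescale, PowerSeries.coeff_rescale,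
    PowerSeries.coeff_mk] at hc
  simp only [bernoulliSeries, PowerSeries.coeff_mk, Nat.factorial_succ] at hc
  push_cast at hc
  have hf : (n ! : ℝ) ≠ 0 := by positivity
  have hn : (n : ℝ) + 1 ≠ 0 := by positivity
  field_simp at hc ⊢
  linear_combination hc

/-- An odd integer part of `x` exchanges the two half arguments modulo 1, which produces the sign
`(-1)^⌊x⌋`. At integers `𝓔₀` is `±1` while the right side is 0, whence the hypothesis. -/
theorem eulerFn_eq_bernoulliFn {n : ℕ} {x : ℝ} (h : n ≠ 0 ∨ Int.fract x ≠ 0) :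
    eulerFn n x = 2 ^ (n + 1) / (n + 1) *
      (bernoulliFn (n + 1) ((x + 1) / 2) - bernoulliFn (n + 1) (x / 2)) := by
  have hy0 := Int.fract_nonneg x
  have hy1 := Int.fract_lt_one x
  have h1 : Int.fract ((Int.fract x + 1) / 2) = (Int.fract x + 1) / 2 :=
    Int.fract_eq_self.2 ⟨by linarith, by linarith⟩
  have h2 : Int.fract (Int.fract x / 2) = Int.fract x / 2 :=
    Int.fract_eq_self.2 ⟨by linarith, by linarith⟩
  have e1 : bernoulliFn (n + 1) ((Int.fract x + 1) / 2) =
      bernoulliFun (n + 1) ((Int.fract x + 1) / 2) := by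
    rw [bernoulliFn_eq_of_ne, h1]
    right
    rw [h1]
    positivity
  have e2 : bernoulliFn (n + 1) (Int.fract x / 2) = bernoulliFun (n + 1) (Int.fract x / 2) := by
    rw [bernoulliFn_eq_of_ne, h2]
    refine h.imp (by omega) fun h => ?_
    rw [h2]
    positivity
  rw [eulerFn, eulerPoly_eq_bernoulliFun, ← e1, ← e2]
  have hx : x = Int.fract x + ⌊x⌋ := (Int.fract_add_floor x).symm
  obtain ⟨l, hl⟩ | ⟨l, hl⟩ := Int.even_or_odd ⌊x⌋
  · have a1 : (x + 1) / 2 = (Int.fract x + 1) / 2 + l := by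
      rw [hl] at hx; push_cast at hx; linarith
    have a2 : x / 2 = Int.fract x / 2 + l := by
      rw [hl] at hx; push_cast at hx; linarith
    rw [a1, a2, bernoulliFn_add_int, bernoulliFn_add_int, Even.neg_one_zpow ⟨l, hl⟩, one_mul]
  · have a1 : (x + 1) / 2 = Int.fract x / 2 + ((l + 1 : ℤ) : ℝ) := by
      rw [hl] at hx; push_cast at hx ⊢; linarith
    have a2 : x / 2 = (Int.fract x + 1) / 2 + l := by
      rw [hl] at hx; push_cast at hx; linarith
    rw [a1, a2, bernoulliFn_add_int, bernoulliFn_add_int, Odd.neg_one_zpow ⟨l, hl⟩]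
    ring

/-! ### Character sums and the shear argument -/

theorem sum_range_natCast {M : Type*} [AddCommMonoid M] {k : ℕ} [NeZero k] (F : ZMod k → M) :
    ∑ e ∈ Finset.range k, F (e : ZMod k) = ∑ z : ZMod k, F z :=
  Finset.sum_bij' (fun e _ => (e : ZMod k)) (fun z _ => z.val) (by simp)
    (fun z _ => Finset.mem_range.2 (ZMod.val_lt z))
    (fun e he => ZMod.val_cast_of_lt (Finset.mem_range.1 he)) (fun z _ => by simp) (by simp)

section Character

variable {k : ℕ} {χ : DirichletCharacter ℂ k}

theorem level_ne_one (hχ : χ ≠ 1) : k ≠ 1 := by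
  rintro rfl
  exact hχ (DirichletCharacter.level_one χ)

theorem apply_zero_of_ne_one (hχ : χ ≠ 1) : χ 0 = 0 := by
  refine χ.map_nonunit ?_
  rw [isUnit_zero_iff]
  intro h
  have h1 : ((1 : ℕ) : ZMod k) = 0 := by rw [Nat.cast_one, h]
  rw [ZMod.natCast_eq_zero_iff, Nat.dvd_one] at h1
  exact level_ne_one hχ h1

theorem apply_natCast_of_dvd (hχ : χ ≠ 1) {n : ℕ} (h : k ∣ n) : χ (n : ZMod k) = 0 := by
  rw [(ZMod.natCast_eq_zero_iff n k).2 h, apply_zero_of_ne_one hχ]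

theorem sum_range_apply [NeZero k] (hχ : χ ≠ 1) : ∑ j ∈ Finset.range k, χ (j : ZMod k) = 0 := by
  rw [sum_range_natCast (fun z => χ z)]
  exact MulChar.sum_eq_zero_of_ne_one hχ

theorem sum_range_conj_apply [NeZero k] (hχ : χ ≠ 1) :
    ∑ j ∈ Finset.range k, starRingEnd ℂ (χ (j : ZMod k)) = 0 := by
  rw [← map_sum, sum_range_apply hχ, map_zero]

theorem sum_range_apply_affine [NeZero k] (hχ : χ ≠ 1) (a : ZMod k) {b : ZMod k} (hb : IsUnit b) :
    ∑ e ∈ Finset.range k, χ (a + b * (e : ZMod k)) = 0 := by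
  rw [sum_range_natCast (fun z => χ (a + b * z)), ← MulChar.sum_eq_zero_of_ne_one hχ]
  exact Fintype.sum_bijective (fun z => a + b * z)
    ((AddGroup.addLeft_bijective a).comp (IsUnit.isUnit_iff_mulLeft_bijective.1 hb)) _ _ fun _ => rfl

/-- The shear `(n, J) ↦ (n + c e, J - d e)` of the index set kills the twisted double sum of a
periodic function of `n / (k c) + J / (k d)`. -/
theorem sum_sum_periodic_eq_zero [NeZero k] (hχ : χ ≠ 1) {d c : ℕ} (hd : 0 < d) (hc : 0 < c)
    (hcop : Nat.Coprime d c) (hdeven : Even d) (hdvd : k ∣ d ∨ k ∣ c) {G : ℝ → ℂ}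
    (hG : Function.Periodic G 1) :
    ∑ n ∈ Finset.range (k * c), ∑ J ∈ Finset.range (k * d),
      starRingEnd ℂ (χ (n : ZMod k)) * ((-1) ^ J * χ (J : ZMod k)) *
        G (n / (k * c : ℝ) + J / (k * d : ℝ)) = 0 := by
  have hk0 : (k : ℝ) ≠ 0 := by exact_mod_cast NeZero.ne k
  have hc0 : (c : ℝ) ≠ 0 := by exact_mod_cast hc.ne'
  have hd0 : (d : ℝ) ≠ 0 := by exact_mod_cast hd.ne'
  let H : ℕ → ℕ → ℂ := fun n J => starRingEnd ℂ (χ (n : ZMod k)) * ((-1) ^ J * χ (J : ZMod k)) *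
        G (n / (k * c : ℝ) + J / (k * d : ℝ))
  have hH1 : ∀ J, Function.Periodic (fun n => H n J) (k * c) := by
    intro J n
    have h : (((n + k * c : ℕ) : ℝ) / (k * c : ℝ) + J / (k * d : ℝ)) =
        n / (k * c : ℝ) + J / (k * d : ℝ) + 1 := by push_cast; field_simp; ring
    simp only [H, h, hG _]
    simp
  have hH2 : ∀ n, Function.Periodic (fun J => H n J) (k * d) := by
    intro n J
    have h : (n / (k * c : ℝ) + ((J + k * d : ℕ) : ℝ) / (k * d : ℝ)) =
        n / (k * c : ℝ) + J / (k * d : ℝ) + 1 := by push_cast; field_simp; ring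
    simp only [H, h, hG _, pow_add, (hdeven.mul_left k).neg_one_pow]
    simp
  -- The factor `k - 1` stands for `-1` mod `k` within ℕ. The argument of `G` grows by `e/k +
  -- (k-1)e/k = e`, an integer.
  have hshift : ∀ e : ℕ, ∑ n ∈ Finset.range (k * c), ∑ J ∈ Finset.range (k * d), H n J =
      ∑ n ∈ Finset.range (k * c), ∑ J ∈ Finset.range (k * d),
        H (n + c * e) (J + d * ((k - 1) * e)) := by
    intro e
    simp_rw [fun n => sum_range_add_of_periodic (hH2 n)]
    have hp : Function.Periodic (fun n => ∑ J ∈ Finset.range (k * d), H n J) (k * c) :=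
      fun n => Finset.sum_congr rfl fun J _ => hH1 J n
    exact (sum_range_add_of_periodic hp (c * e)).symm
  have hk1 : (((k - 1 : ℕ) : ZMod k)) = -1 := by
    rw [Nat.cast_sub (NeZero.one_le)]; simp
  have hval : ∀ n J e : ℕ, H (n + c * e) (J + d * ((k - 1) * e)) =
      (-1) ^ J * G (n / (k * c : ℝ) + J / (k * d : ℝ)) *
        (starRingEnd ℂ (χ ((n : ZMod k) + c * e)) * χ ((J : ZMod k) + -d * e)) := by
    intro n J e
    have h : (((n + c * e : ℕ) : ℝ) / (k * c : ℝ) +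
        ((J + d * ((k - 1) * e) : ℕ) : ℝ) / (k * d : ℝ)) =
        n / (k * c : ℝ) + J / (k * d : ℝ) + (e : ℕ) * 1 := by
      push_cast [Nat.cast_sub (NeZero.one_le : 1 ≤ k)]; field_simp; ring
    have h2 : (((J + d * ((k - 1) * e) : ℕ) : ZMod k)) = (J : ZMod k) + -d * e := by
      push_cast; rw [hk1]; ring
    simp only [H, h, hG.nat_mul e _, pow_add, (hdeven.mul_right _).neg_one_pow, h2]
    push_cast
    ring
  -- One character does not see `e`, since `k` divides its step; the step of the other is a unit mod
  -- `k` by coprimality, so it runs over all residues.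
  have hinner : ∀ n J : ℕ, ∑ e ∈ Finset.range k,
      starRingEnd ℂ (χ ((n : ZMod k) + c * e)) * χ ((J : ZMod k) + -d * e) = 0 := by
    intro n J
    rcases hdvd with h | h
    · have hd' : (d : ZMod k) = 0 := (ZMod.natCast_eq_zero_iff d k).2 h
      have hu : IsUnit (c : ZMod k) :=
        (ZMod.isUnit_iff_coprime c k).2 (hcop.symm.coprime_dvd_right h)
      simp only [hd', neg_zero, zero_mul, add_zero]
      rw [← Finset.sum_mul, ← map_sum, sum_range_apply_affine hχ _ hu, map_zero, zero_mul]
    · have hc' : (c : ZMod k) = 0 := (ZMod.natCast_eq_zero_iff c k).2 h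
      have hu : IsUnit (-(d : ZMod k)) :=
        ((ZMod.isUnit_iff_coprime d k).2 (hcop.coprime_dvd_right h)).neg
      simp only [hc', zero_mul, add_zero]
      rw [← Finset.mul_sum, sum_range_apply_affine hχ _ hu, mul_zero]
  have hsum : ∑ e ∈ Finset.range k,
      ∑ n ∈ Finset.range (k * c), ∑ J ∈ Finset.range (k * d), H n J = 0 := by
    rw [Finset.sum_congr rfl fun e _ => hshift e, Finset.sum_comm]
    refine Finset.sum_eq_zero fun n _ => ?_
    rw [Finset.sum_comm]
    refine Finset.sum_eq_zero fun J _ => ?_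
    simp_rw [hval]
    rw [← Finset.mul_sum, hinner, mul_zero]
  rw [Finset.sum_const, Finset.card_range, nsmul_eq_mul] at hsum
  exact (mul_eq_zero.1 hsum).resolve_left (by exact_mod_cast NeZero.ne k)

/-- `𝔅_{i,χ}(0)` vanishes unless `χ(-1) = (-1)ⁱ`. -/
theorem bernoulliChi_parity [NeZero k] (hχ : χ ≠ 1) (i : ℕ) :
    χ (-1) * (-1) ^ i * bernoulliChi i χ 0 = bernoulliChi i χ 0 := by
  have hk0 : (k : ℝ) ≠ 0 := by exact_mod_cast NeZero.ne k
  let h : ℕ → ℂ := fun j => starRingEnd ℂ (χ (j : ZMod k)) *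
    (bernoulliFn i (((j : ℝ) + 0) / (k : ℝ)) : ℂ)
  have hh : Function.Periodic h k := by
    intro j
    have e : (((j + k : ℕ) : ℝ) + 0) / (k : ℝ) = (j + 0) / k + 1 := by push_cast; field_simp; ring
    simp only [h, e, bernoulliFn_add_one]
    simp
  -- The substitution `j ↦ k - j` trades `χ(j)` for `χ(-1)χ(j)` and reflects the Bernoulli function.
  have hrefl : ∑ j ∈ Finset.range k, h j = ∑ j ∈ Finset.range k, h (k - j) := by
    rw [← sum_range_add_of_periodic hh 1, ← Finset.sum_range_reflect]
    refine Finset.sum_congr rfl fun j hj => ?_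
    have := Finset.mem_range.1 hj
    congr 1
    omega
  rw [bernoulliChi]
  change _ * (_ * ∑ j ∈ Finset.range k, h j) = _ * ∑ j ∈ Finset.range k, h j
  rw [mul_left_comm]
  congr 1
  conv_rhs => rw [hrefl]
  rw [Finset.mul_sum]
  refine Finset.sum_congr rfl fun j hj => ?_
  have hj' := Finset.mem_range.1 hj
  by_cases h0 : j = 0
  · subst h0
    simp [h, apply_zero_of_ne_one hχ]
  · have hf : Int.fract ((j : ℝ) / k) = j / k :=
      Int.fract_eq_self.2 ⟨by positivity, (div_lt_one (by positivity)).2 (by exact_mod_cast hj')⟩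
    have hf0 : Int.fract ((j : ℝ) / k) ≠ 0 := by
      rw [hf]
      have : (j : ℝ) ≠ 0 := by exact_mod_cast h0
      positivity
    have e : ((k - j : ℕ) : ℝ) / k = -(j / k) + 1 := by
      rw [Nat.cast_sub hj'.le]; field_simp; ring
    have e2 : ((k - j : ℕ) : ZMod k) = -1 * (j : ZMod k) := by
      rw [Nat.cast_sub hj'.le]; simp
    simp only [h, add_zero, e, e2, bernoulliFn_add_one, bernoulliFn_neg i hf0, map_mul]
    push_cast
    have : starRingEnd ℂ (χ (-1)) = χ (-1) := by
      rcases χ.even_or_odd with h | h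
      · rw [h]; simp
      · rw [h]; simp
    rw [this]
    ring

/-! ### Hardy–Berndt sums as double sums of Bernoulli functions -/

/-- The character Euler function in terms of Bernoulli functions, away from the discontinuities
of `𝓔₀`. -/
theorem eulerChi_eq (hk : Odd k) (ψ : DirichletCharacter ℂ k) (m : ℕ) (x : ℝ)
    (h : ∀ j : ℕ, ψ (j : ZMod k) = 0 ∨ m ≠ 0 ∨ Int.fract ((j + x) / k) ≠ 0) :
    eulerChi m ψ x = -((k : ℂ) ^ m * 2 ^ (m + 1) / (m + 1)) *
      ∑ J ∈ Finset.range (k * 2), (-1) ^ J * starRingEnd ℂ (ψ (J : ZMod k)) *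
        (bernoulliFn (m + 1) (J / ((k * 2 : ℕ) : ℝ) + x / ((k * 2 : ℕ) : ℝ)) : ℂ) := by
  have hk0 : (k : ℝ) ≠ 0 := by exact_mod_cast hk.pos.ne'
  rw [eulerChi, sum_range_mul_eq, Finset.mul_sum, Finset.mul_sum]
  refine Finset.sum_congr rfl fun j _ => ?_
  -- The indices `J = j` and `J = j + k` give the two half arguments; `k` odd makes their signs
  -- opposite.
  rw [Finset.sum_range_succ, Finset.sum_range_one]
  have e1 : ((j + k * 0 : ℕ) : ℝ) / ((k * 2 : ℕ) : ℝ) + x / ((k * 2 : ℕ) : ℝ) =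
      (j + x) / k / 2 := by push_cast; field_simp; ring
  have e2 : ((j + k * 1 : ℕ) : ℝ) / ((k * 2 : ℕ) : ℝ) + x / ((k * 2 : ℕ) : ℝ) =
      ((j + x) / k + 1) / 2 := by push_cast; field_simp; ring
  rw [e1, e2]
  rcases h j with h | h
  · simp [h]
  · rw [eulerFn_eq_bernoulliFn h]
    have e3 : (((j + k * 1 : ℕ) : ZMod k)) = j := by simp
    have e4 : (((j + k * 0 : ℕ) : ZMod k)) = j := by simp
    rw [e3, e4, mul_one, mul_zero, add_zero, pow_add (-1 : ℂ) j k, hk.neg_one_pow]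
    push_cast
    ring

/-- `p` times the first Hardy--Berndt sum as a double sum of Bernoulli functions, `p = q + 1`. -/
theorem s1_eq_sum_sum (hk : Odd k) (hχ : χ ≠ 1) {d c : ℕ} (hd : 0 < d) (hc : 0 < c)
    (hcop : Nat.Coprime d c) (hdeven : Even d) (hdvd : k ∣ d ∨ k ∣ c) (q : ℕ) :
    ((q : ℂ) + 1) * s1 (q + 1) d c (star χ) = -2 * ((k : ℂ) * d) ^ q *
      ∑ n ∈ Finset.range (k * c), ∑ J ∈ Finset.range (k * d),
        starRingEnd ℂ (χ (n : ZMod k)) * ((-1) ^ J * χ (J : ZMod k)) *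
          ((bernoulliFn (q + 1) (n / (k * c : ℝ) + J / (k * d : ℝ)) : ℂ) *
            (bernoulliFn 1 (n / (k * c : ℝ)) : ℂ)) := by
  have hkn : k ≠ 0 := hk.pos.ne'
  have hk0 : (k : ℝ) ≠ 0 := by exact_mod_cast hkn
  have hc0 : (c : ℝ) ≠ 0 := by exact_mod_cast hc.ne'
  obtain ⟨D, rfl⟩ : ∃ D, d = 2 * D := hdeven.two_dvd
  have hD : D ≠ 0 := by omega
  have hDC : (D : ℂ) ≠ 0 := by exact_mod_cast hD
  have hqC : (q : ℂ) + 1 ≠ 0 := by exact_mod_cast Nat.succ_ne_zero q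
  rw [s1, sum_Icc_one_eq_sum_range, mul_comm c k, Finset.mul_sum, Finset.mul_sum]
  swap
  · have h1 : (star χ) ((c * k : ℕ) : ZMod k) = 0 := by
      rw [MulChar.star_apply, apply_natCast_of_dvd hχ (Dvd.intro_left c rfl), star_zero]
    have h0 : (star χ) ((0 : ℕ) : ZMod k) = 0 := by
      rw [MulChar.star_apply, apply_natCast_of_dvd hχ (dvd_zero k), star_zero]
    rw [h1, h0]
    simp
  refine Finset.sum_congr rfl fun n _ => ?_
  have hs : (star χ) (n : ZMod k) = starRingEnd ℂ (χ (n : ZMod k)) := MulChar.star_apply ..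
  rw [hs]
  by_cases hn : χ (n : ZMod k) = 0
  · simp [hn]
  have hkn' : ¬ k ∣ n := fun h => hn (apply_natCast_of_dvd hχ h)
  rw [Nat.add_sub_cancel, eulerChi_eq hk]
  swap
  · intro j
    -- At a discontinuity `c ∣ d n`, hence `c ∣ n`. If `k ∣ c` this contradicts `χ(n) ≠ 0`; if `k ∣
    -- d` it forces `k ∣ j`, where the character vanishes.
    by_cases hj : Int.fract (((j : ℝ) + (((2 * D : ℕ) : ℤ) : ℝ) * n / c) / k) = 0
    · left
      rw [MulChar.star_apply, star_eq_zero]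
      refine apply_natCast_of_dvd hχ ?_
      obtain ⟨z, hz⟩ := Int.fract_eq_zero_iff.1 hj
      have hz' : (z : ℝ) * (k * c) = c * j + ((2 * D : ℕ) : ℝ) * n := by
        rw [hz]; push_cast; field_simp
      have hzi : z * (k * c) = c * j + ((2 * D : ℕ) : ℤ) * n := by exact_mod_cast hz'
      have hcn : c ∣ n := by
        have : (c : ℤ) ∣ ((2 * D * n : ℕ) : ℤ) :=
          ⟨z * k - j, by push_cast at hzi ⊢; linear_combination -hzi⟩
        exact (hcop.symm).dvd_of_dvd_mul_left (Int.natCast_dvd_natCast.1 this)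
      rcases hdvd with hkd | hkc
      · obtain ⟨a, ha⟩ := hcn
        obtain ⟨b, hb⟩ := hkd
        rw [hb, ha] at hzi
        have hci : (c : ℤ) ≠ 0 := by exact_mod_cast hc.ne'
        refine Int.natCast_dvd_natCast.1 ⟨z - b * a, mul_left_cancel₀ hci ?_⟩
        push_cast at hzi
        linear_combination -hzi
      · exact absurd (hkc.trans hcn) hkn'
    · exact Or.inr (Or.inr hj)
  have hf : Function.Periodic
      (fun J : ℕ => (-1) ^ J * starRingEnd ℂ ((star χ) (J : ZMod k))) (k * 2) := by
    intro J
    simp [pow_add, pow_mul']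
  -- The weight `(-1)^J χ(J)` has period `2k`; `d = 2D` lets the multiplication theorem with factor
  -- `D` reach modulus `kd`.
  have ht := sum_periodic_mul_bernoulliFn (q + 1) (mul_ne_zero hkn two_ne_zero) hD hf
    (n / (k * c : ℝ))
  have hx : ∀ J : ℕ, (J : ℝ) / ((k * 2 : ℕ) : ℝ) +
      (((2 * D : ℕ) : ℤ) : ℝ) * n / c / ((k * 2 : ℕ) : ℝ) =
      J / ((k * 2 : ℕ) : ℝ) + D * (n / (k * c : ℝ)) := by
    intro J; push_cast; field_simp
  simp_rw [hx]
  rw [← ht, show k * 2 * D = k * (2 * D) by ring, mul_comm (c : ℝ) k]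
  have hsum : ∑ J ∈ Finset.range (k * (2 * D)),
        (-1) ^ J * starRingEnd ℂ ((star χ) (J : ZMod k)) *
          (bernoulliFn (q + 1) (J / (((k * 2 : ℕ) : ℝ) * D) + n / (k * c : ℝ)) : ℂ) =
      ∑ J ∈ Finset.range (k * (2 * D)), (-1) ^ J * χ (J : ZMod k) *
          (bernoulliFn (q + 1) (n / (k * c : ℝ) + J / (k * ((2 * D : ℕ) : ℝ))) : ℂ) := by
    refine Finset.sum_congr rfl fun J _ => ?_
    rw [MulChar.star_apply, ← starRingEnd_apply, Complex.conj_conj, add_comm (n / (k * c : ℝ))]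
    push_cast
    rw [mul_assoc (k : ℝ)]
  rw [hsum]
  have hpull : ∑ J ∈ Finset.range (k * (2 * D)),
        starRingEnd ℂ (χ (n : ZMod k)) * ((-1) ^ J * χ (J : ZMod k)) *
          ((bernoulliFn (q + 1) (n / (k * c : ℝ) + J / (k * ((2 * D : ℕ) : ℝ))) : ℂ) *
            (bernoulliFn 1 (n / (k * c : ℝ)) : ℂ)) =
      starRingEnd ℂ (χ (n : ZMod k)) * (bernoulliFn 1 (n / (k * c : ℝ)) : ℂ) *
        ∑ J ∈ Finset.range (k * (2 * D)), (-1) ^ J * χ (J : ZMod k) *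
          (bernoulliFn (q + 1) (n / (k * c : ℝ) + J / (k * ((2 * D : ℕ) : ℝ))) : ℂ) := by
    rw [Finset.mul_sum]
    exact Finset.sum_congr rfl fun J _ => by ring
  rw [hpull]
  generalize (∑ J ∈ Finset.range (k * (2 * D)), (-1) ^ J * χ (J : ZMod k) *
          (bernoulliFn (q + 1) (n / (k * c : ℝ) + J / (k * ((2 * D : ℕ) : ℝ))) : ℂ)) = S
  push_cast
  field_simp
  ring

/-- The second Hardy--Berndt sum as a double sum of Bernoulli functions, `p = q + 1`. -/
theorem s2_eq_sum_sum (hk : k ≠ 0) (hχ : χ ≠ 1) {d c : ℕ} (hd : 0 < d) (hc : 0 < c) (q : ℕ) :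
    s2 (q + 1) c d χ = ((k : ℂ) * c) ^ q *
      ∑ n ∈ Finset.range (k * c), ∑ J ∈ Finset.range (k * d),
        starRingEnd ℂ (χ (n : ZMod k)) * ((-1) ^ J * χ (J : ZMod k)) *
          ((bernoulliFn (q + 1) (n / (k * c : ℝ) + J / (k * d : ℝ)) : ℂ) *
            (bernoulliFn 1 (J / (k * d : ℝ)) : ℂ)) := by
  have hk0 : (k : ℝ) ≠ 0 := by exact_mod_cast hk
  have hd0 : (d : ℝ) ≠ 0 := by exact_mod_cast hd.ne'
  have hcC : (c : ℂ) ≠ 0 := by exact_mod_cast hc.ne'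
  rw [s2, sum_Icc_one_eq_sum_range, mul_comm d k, Finset.sum_comm, Finset.mul_sum]
  swap
  · have h1 : χ ((d * k : ℕ) : ZMod k) = 0 := apply_natCast_of_dvd hχ (Dvd.intro_left d rfl)
    have h0 : χ ((0 : ℕ) : ZMod k) = 0 := apply_natCast_of_dvd hχ (dvd_zero k)
    rw [h1, h0]
    simp
  refine Finset.sum_congr rfl fun J _ => ?_
  have hg : Function.Periodic (fun n : ℕ => starRingEnd ℂ (χ (n : ZMod k))) k := by
    intro n
    simp
  have ht := sum_periodic_mul_bernoulliFn (q + 1) hk hc.ne' hg (J / (k * d : ℝ))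
  have hx : ∀ j : ℕ, ((j : ℝ) + ((c : ℤ) : ℝ) * J / d) / k = j / k + c * (J / (k * d : ℝ)) := by
    intro j; push_cast; field_simp
  rw [bernoulliChi]
  simp_rw [hx]
  rw [← ht, mul_comm (d : ℝ) k, Nat.add_sub_cancel]
  have hpull : ∑ n ∈ Finset.range (k * c),
        starRingEnd ℂ (χ (n : ZMod k)) * ((-1) ^ J * χ (J : ZMod k)) *
          ((bernoulliFn (q + 1) (n / (k * c : ℝ) + J / (k * d : ℝ)) : ℂ) *
            (bernoulliFn 1 (J / (k * d : ℝ)) : ℂ)) =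
      ((-1) ^ J * χ (J : ZMod k)) * (bernoulliFn 1 (J / (k * d : ℝ)) : ℂ) *
        ∑ n ∈ Finset.range (k * c), starRingEnd ℂ (χ (n : ZMod k)) *
          (bernoulliFn (q + 1) (n / (k * c : ℝ) + J / (k * d : ℝ)) : ℂ) := by
    rw [Finset.mul_sum]
    exact Finset.sum_congr rfl fun n _ => by ring
  rw [hpull]
  generalize (∑ n ∈ Finset.range (k * c), starRingEnd ℂ (χ (n : ZMod k)) *
          (bernoulliFn (q + 1) (n / (k * c : ℝ) + J / (k * d : ℝ)) : ℂ)) = S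
  rw [mul_pow]
  field_simp
  ring

/-! ### Values at zero and vanishing weight sums -/

/-- The multiplication theorem at `x = 0`; it identifies the factor in `n` that the product formula
leaves. -/
theorem bernoulliChi_zero_eq (hk : k ≠ 0) {c : ℕ} (hc : 0 < c) (s : ℕ) :
    bernoulliChi (s + 1) χ 0 = ((k : ℂ) * c) ^ s *
      ∑ n ∈ Finset.range (k * c), starRingEnd ℂ (χ (n : ZMod k)) *
        (bernoulliFn (s + 1) (n / (k * c : ℝ)) : ℂ) := by
  have hcC : (c : ℂ) ≠ 0 := by exact_mod_cast hc.ne'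
  have hg : Function.Periodic (fun n : ℕ => starRingEnd ℂ (χ (n : ZMod k))) k := by
    intro n
    simp
  have ht := sum_periodic_mul_bernoulliFn (s + 1) hk hc.ne' hg 0
  simp only [add_zero, mul_zero] at ht
  rw [bernoulliChi]
  simp only [add_zero, Nat.add_sub_cancel]
  rw [← ht, mul_pow]
  field_simp
  ring

/-- Identifies the factor in `J`. Discontinuities of `𝓔₀` occur only at `k ∣ j`, where the character
vanishes. -/
theorem eulerChi_star_zero_eq (hk : Odd k) (hχ : χ ≠ 1) {d : ℕ} (hd : 0 < d) (hdeven : Even d)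
    (r : ℕ) :
    ((r : ℂ) + 1) * eulerChi r (star χ) 0 = -2 * ((k : ℂ) * d) ^ r *
      ∑ J ∈ Finset.range (k * d), (-1) ^ J * χ (J : ZMod k) *
        (bernoulliFn (r + 1) (J / (k * d : ℝ)) : ℂ) := by
  have hkn : k ≠ 0 := hk.pos.ne'
  have hk0 : (k : ℝ) ≠ 0 := by exact_mod_cast hkn
  obtain ⟨D, rfl⟩ : ∃ D, d = 2 * D := hdeven.two_dvd
  have hD : D ≠ 0 := by omega
  have hDC : (D : ℂ) ≠ 0 := by exact_mod_cast hD
  have hrC : (r : ℂ) + 1 ≠ 0 := by exact_mod_cast Nat.succ_ne_zero r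
  rw [eulerChi_eq hk]
  swap
  · intro j
    by_cases hj : Int.fract (((j : ℝ) + 0) / k) = 0
    · left
      rw [MulChar.star_apply, star_eq_zero]
      refine apply_natCast_of_dvd hχ ?_
      obtain ⟨z, hz⟩ := Int.fract_eq_zero_iff.1 hj
      have hz' : (j : ℝ) = k * z := by rw [hz]; field_simp; ring
      exact Int.natCast_dvd_natCast.1 ⟨z, by exact_mod_cast hz'⟩
    · exact Or.inr (Or.inr hj)
  have hf : Function.Periodic
      (fun J : ℕ => (-1) ^ J * starRingEnd ℂ ((star χ) (J : ZMod k))) (k * 2) := by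
    intro J
    simp [pow_add, pow_mul']
  have ht := sum_periodic_mul_bernoulliFn (r + 1) (mul_ne_zero hkn two_ne_zero) hD hf 0
  simp only [add_zero, mul_zero, zero_div] at ht ⊢
  rw [← ht, show k * 2 * D = k * (2 * D) by ring]
  have hsum : ∑ J ∈ Finset.range (k * (2 * D)),
        (-1) ^ J * starRingEnd ℂ ((star χ) (J : ZMod k)) *
          (bernoulliFn (r + 1) (J / (((k * 2 : ℕ) : ℝ) * D)) : ℂ) =
      ∑ J ∈ Finset.range (k * (2 * D)), (-1) ^ J * χ (J : ZMod k) *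
          (bernoulliFn (r + 1) (J / (k * ((2 * D : ℕ) : ℝ))) : ℂ) := by
    refine Finset.sum_congr rfl fun J _ => ?_
    rw [MulChar.star_apply, ← starRingEnd_apply, Complex.conj_conj]
    push_cast
    rw [mul_assoc (k : ℝ)]
  rw [hsum]
  generalize (∑ J ∈ Finset.range (k * (2 * D)), (-1) ^ J * χ (J : ZMod k) *
          (bernoulliFn (r + 1) (J / (k * ((2 * D : ℕ) : ℝ))) : ℂ)) = S
  push_cast
  field_simp
  ring

theorem sum_range_conj_apply_mul [NeZero k] (hχ : χ ≠ 1) (c : ℕ) :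
    ∑ n ∈ Finset.range (k * c), starRingEnd ℂ (χ (n : ZMod k)) = 0 := by
  rw [sum_range_mul_eq, Finset.sum_comm]
  refine Finset.sum_eq_zero fun a _ => ?_
  simpa using sum_range_conj_apply hχ

/-- The terms `J` and `J + k` cancel because `k` is odd. This removes the products containing `𝔅₀(v)
= 1`. -/
theorem sum_range_neg_one_pow_mul_apply (hk : Odd k) {d : ℕ} (hdeven : Even d) :
    ∑ J ∈ Finset.range (k * d), (-1) ^ J * χ (J : ZMod k) = 0 := by
  obtain ⟨D, rfl⟩ : ∃ D, d = 2 * D := hdeven.two_dvd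
  rw [← mul_assoc, sum_range_mul_eq, Finset.sum_comm]
  refine Finset.sum_eq_zero fun a _ => ?_
  rw [sum_range_mul_eq]
  refine Finset.sum_eq_zero fun j _ => ?_
  have h (x : ℕ) : (-1 : ℂ) ^ (j + k * x + k * 2 * a) = (-1) ^ j * (-1) ^ x := by
    rw [mul_assoc k, mul_left_comm k, pow_add, pow_add, pow_mul, pow_mul, hk.neg_one_pow]
    simp
  rw [Finset.sum_range_succ, Finset.sum_range_one, h, h]
  simp

end Character

/-! ### Reciprocity -/

section Reciprocity

variable {k : ℕ} {χ : DirichletCharacter ℂ k}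

theorem fract_natCast_div_ne_zero {N n : ℕ} (hk : k ≠ 0) (hN : 0 < N) (h : ¬ k ∣ n) :
    Int.fract (n / (k * N : ℝ)) ≠ 0 := by
  have hk0 : (k : ℝ) ≠ 0 := by exact_mod_cast hk
  have hN0 : (N : ℝ) ≠ 0 := by exact_mod_cast hN.ne'
  intro h0
  obtain ⟨z, hz⟩ := Int.fract_eq_zero_iff.1 h0
  refine h (Int.natCast_dvd_natCast.1 ⟨N * z, ?_⟩)
  have : (n : ℝ) = k * (N * z) := by rw [hz]; field_simp
  exact_mod_cast this

/-- The twisted sum over all pairs of the pointwise product formula for Bernoulli functions. -/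
theorem sum_sum_bernoulliFn_mul_add (hk : k ≠ 0) (hχ : χ ≠ 1) {d c : ℕ} (hd : 0 < d) (hc : 0 < c)
    (hcop : Nat.Coprime d c) (hdeven : Even d) (hdvd : k ∣ d ∨ k ∣ c) {p : ℕ} (hp : 1 ≤ p) :
    ((p : ℂ) + 1) * ∑ n ∈ Finset.range (k * c), ∑ J ∈ Finset.range (k * d),
        starRingEnd ℂ (χ (n : ZMod k)) * ((-1) ^ J * χ (J : ZMod k)) *
          ((bernoulliFn p (n / (k * c : ℝ) + J / (k * d : ℝ)) : ℂ) *
            ((bernoulliFn 1 (n / (k * c : ℝ)) : ℂ) + (bernoulliFn 1 (J / (k * d : ℝ)) : ℂ))) =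
      ∑ i ∈ Finset.range (p + 2), ((p + 1).choose i : ℂ) *
        ((∑ n ∈ Finset.range (k * c), starRingEnd ℂ (χ (n : ZMod k)) *
            (bernoulliFn i (n / (k * c : ℝ)) : ℂ)) *
          ∑ J ∈ Finset.range (k * d), (-1) ^ J * χ (J : ZMod k) *
            (bernoulliFn (p + 1 - i) (J / (k * d : ℝ)) : ℂ)) := by
  have : NeZero k := ⟨hk⟩
  have hG : Function.Periodic (fun x : ℝ => (bernoulliFn (p + 1) x : ℂ)) 1 :=
    fun x => by simp only [bernoulliFn_add_one]
  have h0 := sum_sum_periodic_eq_zero hχ hd hc hcop hdeven hdvd hG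
  have hpt : ∀ n J : ℕ, ((p : ℂ) + 1) *
      (starRingEnd ℂ (χ (n : ZMod k)) * ((-1) ^ J * χ (J : ZMod k)) *
          ((bernoulliFn p (n / (k * c : ℝ) + J / (k * d : ℝ)) : ℂ) *
            ((bernoulliFn 1 (n / (k * c : ℝ)) : ℂ) + (bernoulliFn 1 (J / (k * d : ℝ)) : ℂ)))) =
      ∑ i ∈ Finset.range (p + 2), ((p + 1).choose i : ℂ) *
        ((starRingEnd ℂ (χ (n : ZMod k)) * (bernoulliFn i (n / (k * c : ℝ)) : ℂ)) *
          ((-1) ^ J * χ (J : ZMod k) * (bernoulliFn (p + 1 - i) (J / (k * d : ℝ)) : ℂ))) +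
      p * (starRingEnd ℂ (χ (n : ZMod k)) * ((-1) ^ J * χ (J : ZMod k)) *
        (bernoulliFn (p + 1) (n / (k * c : ℝ) + J / (k * d : ℝ)) : ℂ)) := by
    intro n J
    by_cases hn : χ (n : ZMod k) = 0
    · simp [hn]
    by_cases hJ : χ (J : ZMod k) = 0
    · simp [hJ]
    have h := bernoulliFn_product_formula hp
      (fract_natCast_div_ne_zero (n := n) hk hc fun h => hn (apply_natCast_of_dvd hχ h))
      (fract_natCast_div_ne_zero (n := J) hk hd fun h => hJ (apply_natCast_of_dvd hχ h))
    have h' := congrArg (fun x : ℝ => starRingEnd ℂ (χ (n : ZMod k)) *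
      ((-1) ^ J * χ (J : ZMod k)) * (x : ℂ)) h
    push_cast at h'
    rw [mul_left_comm, h', mul_add, Finset.mul_sum]
    congr 1
    · exact Finset.sum_congr rfl fun i _ => by ring
    · ring
  have hS : ∀ i : ℕ, ((p + 1).choose i : ℂ) *
        ((∑ n ∈ Finset.range (k * c), starRingEnd ℂ (χ (n : ZMod k)) *
            (bernoulliFn i (n / (k * c : ℝ)) : ℂ)) *
          ∑ J ∈ Finset.range (k * d), (-1) ^ J * χ (J : ZMod k) *
            (bernoulliFn (p + 1 - i) (J / (k * d : ℝ)) : ℂ)) =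
      ∑ n ∈ Finset.range (k * c), ∑ J ∈ Finset.range (k * d), ((p + 1).choose i : ℂ) *
        ((starRingEnd ℂ (χ (n : ZMod k)) * (bernoulliFn i (n / (k * c : ℝ)) : ℂ)) *
          ((-1) ^ J * χ (J : ZMod k) * (bernoulliFn (p + 1 - i) (J / (k * d : ℝ)) : ℂ))) := by
    intro i
    rw [Finset.sum_mul_sum, Finset.mul_sum]
    exact Finset.sum_congr rfl fun n _ => Finset.mul_sum ..
  rw [Finset.sum_congr rfl fun i _ => hS i, Finset.sum_comm (s := Finset.range (p + 2)),
    Finset.mul_sum]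
  -- Adding `p` times the vanishing sheared sum reduces the claim to the pointwise formula `hpt`.
  rw [← add_zero (∑ n ∈ Finset.range (k * c), ∑ i ∈ Finset.range (p + 2), _),
    ← mul_zero (p : ℂ), ← h0, Finset.mul_sum, ← Finset.sum_add_distrib]
  refine Finset.sum_congr rfl fun n _ => ?_
  rw [Finset.sum_comm, Finset.mul_sum, Finset.mul_sum, ← Finset.sum_add_distrib]
  exact Finset.sum_congr rfl fun J _ => hpt n J

/-- Reciprocity for the character Hardy--Berndt sums. -/
theorem reciprocity (hk : Odd k) (hχ : χ ≠ 1) {d c : ℕ} (hd : 0 < d) (hc : 0 < c)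
    (hcop : Nat.Coprime d c) (hdeven : Even d) (hdvd : k ∣ d ∨ k ∣ c) {p : ℕ} (hp : Odd p) :
    (p : ℂ) * (d : ℂ) * (c : ℂ) ^ p * s1 p (d : ℤ) c (star χ)
        - 2 * (c : ℂ) * (d : ℂ) ^ p * s2 p (c : ℤ) d χ =
      χ (-1) * ∑ m ∈ Finset.Icc 1 p,
        (-1 : ℂ) ^ m * (Nat.choose p (m - 1) : ℂ) * (c : ℂ) ^ m * (d : ℂ) ^ (p + 1 - m) *
          bernoulliChi (p + 1 - m) χ 0 * eulerChi (m - 1) (star χ) 0 := by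
  have hkn : k ≠ 0 := hk.pos.ne'
  have : NeZero k := ⟨hkn⟩
  have hdouble := sum_sum_bernoulliFn_mul_add hkn hχ hd hc hcop hdeven hdvd hp.pos
  let U : ℕ → ℂ := fun i => ∑ n ∈ Finset.range (k * c), starRingEnd ℂ (χ (n : ZMod k)) *
    (bernoulliFn i (n / (k * c : ℝ)) : ℂ)
  let V : ℕ → ℂ := fun i => ∑ J ∈ Finset.range (k * d), (-1) ^ J * χ (J : ZMod k) *
    (bernoulliFn i (J / (k * d : ℝ)) : ℂ)
  have hU0 : U 0 = 0 := by
    simpa [U, bernoulliFn_zero_left] using sum_range_conj_apply_mul hχ c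
  have hV0 : V 0 = 0 := by
    simpa [V, bernoulliFn_zero_left] using sum_range_neg_one_pow_mul_apply (χ := χ) hk hdeven
  -- The index is reversed to count the Euler factor; the two end terms contain `V 0` or `U 0` and
  -- drop out.
  have hsplit : ∑ i ∈ Finset.range (p + 2), ((p + 1).choose i : ℂ) * (U i * V (p + 1 - i)) =
      ∑ m ∈ Finset.Icc 1 p, ((p + 1).choose m : ℂ) * (U (p + 1 - m) * V m) := by
    rw [← Finset.sum_range_reflect]
    symm
    have hsub : Finset.Icc 1 p ⊆ Finset.range (p + 2) := by
      intro m hm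
      rw [Finset.mem_Icc] at hm
      rw [Finset.mem_range]
      omega
    rw [Finset.sum_subset hsub]
    · refine Finset.sum_congr rfl fun m hm => ?_
      have hm' := Finset.mem_range.1 hm
      rw [show p + 2 - 1 - m = p + 1 - m by omega, show p + 1 - (p + 1 - m) = m by omega,
        Nat.choose_symm (by omega)]
    · intro m hm hm'
      rw [Finset.mem_range] at hm
      rw [Finset.mem_Icc] at hm'
      obtain rfl | rfl : m = 0 ∨ m = p + 1 := by omega
      · rw [hV0, mul_zero, mul_zero]
      · rw [Nat.sub_self, hU0, zero_mul, mul_zero]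
  rw [show (∑ i ∈ Finset.range (p + 2), _) = ∑ i ∈ Finset.range (p + 2),
    ((p + 1).choose i : ℂ) * (U i * V (p + 1 - i)) from rfl, hsplit] at hdouble
  obtain ⟨q, rfl⟩ : ∃ q, p = q + 1 := ⟨p - 1, by have := hp.pos; omega⟩
  have h1 := s1_eq_sum_sum hk hχ hd hc hcop hdeven hdvd q
  have h2 := s2_eq_sum_sum (χ := χ) hkn hχ hd hc q
  simp only [mul_add, Finset.sum_add_distrib] at hdouble
  simp only [← mul_add] at hdouble
  have hp0 : ((q + 1 : ℕ) : ℂ) + 1 ≠ 0 := by exact_mod_cast Nat.succ_ne_zero (q + 1)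
  refine mul_left_cancel₀ hp0 ?_
  -- The weights `d c^p` and `c d^p` give both double sums the common factor `-2 k^q (cd)^{q+1}`.
  have hL : (((q + 1 : ℕ) : ℂ) + 1) *
      (((q + 1 : ℕ) : ℂ) * (d : ℂ) * (c : ℂ) ^ (q + 1) * s1 (q + 1) (d : ℤ) c (star χ)
        - 2 * (c : ℂ) * (d : ℂ) ^ (q + 1) * s2 (q + 1) (c : ℤ) d χ) =
      -2 * (k : ℂ) ^ q * ((c : ℂ) * d) ^ (q + 1) *
        ∑ m ∈ Finset.Icc 1 (q + 1), ((q + 1 + 1).choose m : ℂ) * (U (q + 1 + 1 - m) * V m) := by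
    rw [← hdouble, h2]
    simp only [mul_pow] at h1 ⊢
    push_cast
    linear_combination ((q : ℂ) + 1 + 1) * d * c ^ (q + 1) * h1
  rw [hL, Finset.mul_sum, Finset.mul_sum, Finset.mul_sum]
  refine Finset.sum_congr rfl fun m hm => ?_
  rw [Finset.mem_Icc] at hm
  obtain ⟨r, rfl⟩ : ∃ r, m = r + 1 := ⟨m - 1, by omega⟩
  obtain ⟨s, rfl⟩ : ∃ s, q = r + s := ⟨q - r, by omega⟩
  rw [show r + s + 1 + 1 - (r + 1) = s + 1 by omega, Nat.add_sub_cancel]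
  have hB : bernoulliChi (s + 1) χ 0 = ((k : ℂ) * c) ^ s * U (s + 1) :=
    bernoulliChi_zero_eq hkn hc s
  have hE : ((r : ℂ) + 1) * eulerChi r (star χ) 0 = -2 * ((k : ℂ) * d) ^ r * V (r + 1) :=
    eulerChi_star_zero_eq hk hχ hd hdeven r
  have hpar := bernoulliChi_parity hχ (s + 1)
  -- As `p` is odd, `m` and `p + 1 - m` have equal parity, so `χ(-1)(-1)^m` is absorbed by `hpar`.
  have hsign : (-1 : ℂ) ^ (r + 1) = (-1) ^ (s + 1) := by
    have he : Even (r + 1 + (s + 1)) := by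
      obtain ⟨t, ht⟩ := hp
      exact ⟨t + 1, by omega⟩
    rcases Nat.even_or_odd (s + 1) with h | h
    · rw [h.neg_one_pow, (Nat.even_add.1 he |>.2 h).neg_one_pow]
    · rw [h.neg_one_pow, (Nat.not_even_iff_odd.1 fun h' =>
        Nat.not_even_iff_odd.2 h (Nat.even_add.1 he |>.1 h')).neg_one_pow]
  -- The factor `r + 1 = m` released here is the one required by `hE`.
  have hch : (((r + s + 1 : ℕ) : ℂ) + 1) * ((r + s + 1).choose r : ℂ) =
      ((r + s + 1 + 1).choose (r + 1) : ℂ) * (r + 1) := by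
    exact_mod_cast Nat.add_one_mul_choose_eq (r + s + 1) r
  rw [hsign]
  calc _ = ((r + s + 1 + 1).choose (r + 1) : ℂ) * c ^ (r + 1) * d ^ (s + 1) *
        (((k : ℂ) * c) ^ s * U (s + 1)) * (-2 * ((k : ℂ) * d) ^ r * V (r + 1)) := by ring
    _ = (((r + s + 1 : ℕ) : ℂ) + 1) * ((r + s + 1).choose r : ℂ) * c ^ (r + 1) * d ^ (s + 1) *
        bernoulliChi (s + 1) χ 0 * eulerChi r (star χ) 0 := by
      rw [← hB, ← hE, hch]; ring
    _ = _ := by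
      conv_lhs => rw [← hpar]
      ring

end Reciprocity

end HardyBerndt

end

theorem mainTheorem2 {k : ℕ} (hk : Odd k) (χ : DirichletCharacter ℂ k)
    (hprim : χ.IsPrimitive) (hχ : χ ≠ 1)
    (d c : ℕ) (hd : 0 < d) (hc : 0 < c) (hcop : Nat.Coprime d c) (hdeven : Even d)
    (hdvd : k ∣ d ∨ k ∣ c) :
    (∀ p : ℕ, Odd p →
      (p : ℂ) * (d : ℂ) * (c : ℂ) ^ p * HardyBerndt.s1 p (d : ℤ) c (star χ)
          - 2 * (c : ℂ) * (d : ℂ) ^ p * HardyBerndt.s2 p (c : ℤ) d χ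
        = χ (-1) * ∑ m ∈ Finset.Icc 1 p,
            (-1 : ℂ) ^ m * (Nat.choose p (m - 1) : ℂ) * (c : ℂ) ^ m * (d : ℂ) ^ (p + 1 - m) *
              HardyBerndt.bernoulliChi (p + 1 - m) χ 0 *
              HardyBerndt.eulerChi (m - 1) (star χ) 0) ∧
    HardyBerndt.s1 1 (d : ℤ) c (star χ) - 2 * HardyBerndt.s2 1 (c : ℤ) d χ
      = -χ (-1) * HardyBerndt.bernoulliChi 1 χ 0 * HardyBerndt.eulerChi 0 (star χ) 0 := by
  refine ⟨fun p hp => HardyBerndt.reciprocity hk hχ hd hc hcop hdeven hdvd hp, ?_⟩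
  have h := HardyBerndt.reciprocity hk hχ hd hc hcop hdeven hdvd odd_one
  have hdC : (d : ℂ) ≠ 0 := by exact_mod_cast hd.ne'
  have hcC : (c : ℂ) ≠ 0 := by exact_mod_cast hc.ne'
  simp only [Finset.Icc_self, Finset.sum_singleton, Nat.cast_one, pow_one, Nat.sub_self,
    Nat.choose_zero_right, Nat.add_sub_cancel] at h
  refine mul_left_cancel₀ (mul_ne_zero hdC hcC) ?_
  linear_combination h
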